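/- Let $d\ge 3$ and $n\ge 1$ be integers with $dn$ even. Give each vertex $v\in[n]$ $d$ clones $(v,1),\dots,(v,d)$, and let $\mathcal P_{d,n}$ be the set of all perfect matchings $G$ of the $dn$ clones; each $G$ also denotes the $d$-regular multigraph on $[n]$ (loops and multiple edges allowed) obtained by identifying the clones of each vertex. The configuration model $\mathbb P$ is the uniform distribution on $\mathcal P_{d,n}$. For $\sigma\in\{\pm1\}^{[n]}$ let $H_G(\sigma)$ be the number of monochromatic edges of $G$ (edges, counted with multiplicity, whose two endpoints have the same spin; a loop is monochromatic). For $\eta\in(-1,1)$ let $\Omega_\eta$ be the set of $\sigma\in\{\pm1\}^{[n]}$ with exactly $\lfloor\frac{1+\eta}{2}n\rfloor$ plus spins. For $\beta>0$ and $\hat\sigma\in\Omega_\eta$, the planted model with spin configuration $\hat\sigma$ is the probability distribution on $\mathcal P_{d,n}$ given by $$\hat{\mathbb P}_{\hat\sigma}(G)=\frac{\mathbb P(G)\,e^{\beta H_G(\hat\sigma)}}{\mathbb E[e^{\beta H_G(\hat\sigma)}]},$$ with expectation $\hat{\mathbb E}_{\hat\sigma}$. A switch of $G\in\mathcal P_{d,n}$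 replaces two distinct edges $\{a,b\},\{c,e\}$ of the matching $G$ by $\{a,e\},\{b,c\}$. Then for every $d\ge3$ and $\beta>0$ there is a constant $C=C(d,\beta)>0$ such that the following holds for all $\eta\in(-1,1)$ and all $n\ge1$ with $dn$ even. Let $L>0$ and let $X:\mathcal P_{d,n}\times\{\pm1\}^{[n]}\to\mathbb R$ be such that, for each $\sigma\in\Omega_\eta$, $|X(G,\sigma)-X(G',\sigma)|\le L$ whenever $G,G'\in\mathcal P_{d,n}$ differ by exactly one switch. Then for all $\hat\sigma\in\Omega_\eta$ and all $t>0$, $$\hat{\mathbb P}_{\hat\sigma}\Big(\big|X(G,\hat\sigma)-\hat{\mathbb E}_{\hat\sigma}[X(G,\hat\sigma)]\big|\ge t\Big)\le 2\exp\Big(-\frac{t^2}{C\,n\,L^2}\Big).$$ -/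

import Mathlib

open MeasureTheory ProbabilityTheory

namespace PlantedModel

/-- The clones (half-edges) of the `n` vertices: clone `(v, i)` is the `i`-th copy of vertex `v`. -/
abbrev Clone (n d : ℕ) : Type := Fin n × Fin d

/-- A perfect matching of the clones, encoded by the map that sends each clone to its partner, that
is, by an involution without fixed points. Forgetting the second coordinate of the clones turns it
into a `d`-regular multigraph on `Fin n` (loops and multiple edges allowed). -/
def Pairing (n d : ℕ) : Type :=
  {m : Clone n d → Clone n d // Function.Involutive m ∧ ∀ x, m x ≠ x}

/-- The partner of the clone `x` in the perfect matching `G`. -/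
def Pairing.partner {n d : ℕ} (G : Pairing n d) (x : Clone n d) : Clone n d := G.1 x

/-- The (finite) set of perfect matchings carries the discrete σ-algebra. -/
instance (n d : ℕ) : MeasurableSpace (Pairing n d) := ⊤

/-- Spin configurations: assignments of `+1` or `-1` to the vertices. -/
abbrev Spin (n : ℕ) : Type := Fin n → ℤˣ

/-- The spin configurations of magnetization density `η`: those with exactly `⌊(1 + η) n / 2⌋` plus
spins. Equivalently `∑ v, σ v ≤ η n < ∑ v, σ v + 2`. -/
def Omega (n : ℕ) (η : ℝ) : Set (Spin n) :=
  {σ | ((Finset.univ.filter (fun v => σ v = 1)).card : ℤ) = ⌊(1 + η) / 2 * (n : ℝ)⌋}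

/-- The number of monochromatic edges of `G` under `σ`, with multiplicity: half the number of clones
whose partner has the same spin (a loop counts as one monochromatic edge). -/
noncomputable def monoEdges {n d : ℕ} (G : Pairing n d) (σ : Spin n) : ℝ :=
  ((Finset.univ.filter (fun x : Clone n d => σ x.1 = σ (G.partner x).1)).card : ℝ) / 2

/-- `G'` arises from `G` by exactly one switch: two distinct edges `{a, b}` and `{c, e}` of `G`
(here `b`, `e` are the partners of `a`, `c`) are replaced by `{a, e}` and `{b, c}`, and all other
edges are kept. -/
def IsSwitch {n d : ℕ} (G G' : Pairing n d) : Prop :=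
  ∃ a c : Clone n d, c ≠ a ∧ c ≠ G.partner a ∧
    G'.partner a = G.partner c ∧ G'.partner (G.partner a) = c ∧
    ∀ x, x ≠ a → x ≠ G.partner a → x ≠ c → x ≠ G.partner c → G'.partner x = G.partner x

/-- The configuration model: a uniformly random perfect matching of the clones. -/
noncomputable def configModel (n d : ℕ) : Measure (Pairing n d) := uniformOn Set.univ

/-- The planted model given the spin configuration `σ`: the configuration model reweighted by the
density `exp (β H_G(σ)) / 𝔼 [exp (β H_G(σ))]`. -/
noncomputable def planted {n d : ℕ} (β : ℝ) (σ : Spin n) : Measure (Pairing n d) :=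
  (configModel n d).tilted (fun G => β * monoEdges G σ)

end PlantedModel

/-- The average of `f` over the finite set `A` with respect to the (unnormalised) weight `w`. -/
noncomputable def weightedAvg {ι : Type*} (A : Finset ι) (w f : ι → ℝ) : ℝ :=
  (∑ i ∈ A, w i * f i) / ∑ i ∈ A, w i

section WeightedAvg

variable {ι κ : Type*} {A : Finset ι} {u w f g : ι → ℝ}

theorem weightedAvg_mono (hw : ∀ i, 0 < w i) (h : ∀ i ∈ A, f i ≤ g i) :
    weightedAvg A w f ≤ weightedAvg A w g :=
  div_le_div_of_nonneg_right
    (Finset.sum_le_sum fun i hi => mul_le_mul_of_nonneg_left (h i hi) (hw i).le)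
    (Finset.sum_nonneg fun i _ => (hw i).le)

theorem weightedAvg_const (hA : A.Nonempty) (hw : ∀ i, 0 < w i) (c : ℝ) :
    weightedAvg A w (fun _ => c) = c := by
  have : 0 < ∑ i ∈ A, w i := Finset.sum_pos (fun i _ => hw i) hA
  rw [weightedAvg, ← Finset.sum_mul]
  field_simp

theorem weightedAvg_add : weightedAvg A w (fun i => f i + g i) =
    weightedAvg A w f + weightedAvg A w g := by
  simp only [weightedAvg, mul_add, Finset.sum_add_distrib, add_div]

theorem weightedAvg_const_mul (c : ℝ) :
    weightedAvg A w (fun i => c * f i) = c * weightedAvg A w f := by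
  simp only [weightedAvg, mul_left_comm, ← Finset.mul_sum, mul_div_assoc]

theorem weightedAvg_neg : weightedAvg A w (fun i => -f i) = -weightedAvg A w f := by
  simpa using weightedAvg_const_mul (A := A) (w := w) (f := f) (-1)

theorem weightedAvg_sub_const (hA : A.Nonempty) (hw : ∀ i, 0 < w i) (c : ℝ) :
    weightedAvg A w (fun i => f i - c) = weightedAvg A w f - c := by
  simp only [sub_eq_add_neg, weightedAvg_add, weightedAvg_const hA hw]

theorem weightedAvg_le (hA : A.Nonempty) (hw : ∀ i, 0 < w i) {c : ℝ} (h : ∀ i ∈ A, f i ≤ c) :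
    weightedAvg A w f ≤ c :=
  (weightedAvg_mono hw h).trans_eq (weightedAvg_const hA hw c)

theorem abs_weightedAvg_sub_le (hA : A.Nonempty) (hw : ∀ i, 0 < w i) {c : ℝ}
    (h : ∀ i ∈ A, |f i - g i| ≤ c) : |weightedAvg A w f - weightedAvg A w g| ≤ c := by
  rw [abs_sub_le_iff]
  constructor
  · have := weightedAvg_mono (f := f) (g := fun i => g i + c) hw
      fun i hi => by linarith [(abs_le.1 (h i hi)).2]
    rw [weightedAvg_add, weightedAvg_const hA hw] at this
    linarith
  · have := weightedAvg_mono (f := g) (g := fun i => f i + c) hw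
      fun i hi => by linarith [(abs_le.1 (h i hi)).1]
    rw [weightedAvg_add, weightedAvg_const hA hw] at this
    linarith

theorem weightedAvg_exp_sub (f : ι → ℝ) (c lam : ℝ) :
    weightedAvg A w (fun i => Real.exp (lam * (f i - c))) =
      Real.exp (-(lam * c)) * weightedAvg A w (fun i => Real.exp (lam * f i)) := by
  rw [← weightedAvg_const_mul]
  congr 1
  funext i
  rw [← Real.exp_add]
  ring_nf

/-- The average over the fibre of `p` through a point. -/
noncomputable def fiberAvg [DecidableEq κ] (A : Finset ι) (w : ι → ℝ) (p : ι → κ) (f : ι → ℝ)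
    (i : ι) : ℝ :=
  weightedAvg (A.filter fun j => p j = p i) w f

theorem sum_mul_fiberAvg [DecidableEq κ] (hw : ∀ i, 0 < w i) (p : ι → κ) {r : ι → ℝ}
    (hr : ∀ i ∈ A, ∀ j ∈ A, p i = p j → r i = r j) :
    ∑ i ∈ A, r i * w i * fiberAvg A w p f i = ∑ i ∈ A, r i * w i * f i := by
  classical
  rw [← Finset.sum_fiberwise_of_maps_to (g := p) (t := A.image p)
      (fun i hi => Finset.mem_image_of_mem p hi),
    ← Finset.sum_fiberwise_of_maps_to (g := p) (t := A.image p)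
      (fun i hi => Finset.mem_image_of_mem p hi)]
  refine Finset.sum_congr rfl fun z hz => ?_
  obtain ⟨k, hk, rfl⟩ := Finset.mem_image.1 hz
  have hpos : 0 < ∑ i ∈ A with p i = p k, w i :=
    Finset.sum_pos (fun i _ => hw i) ⟨k, by simp [hk]⟩
  have h1 : ∀ i ∈ A.filter fun j => p j = p k,
      r i * w i * fiberAvg A w p f i = r k * weightedAvg (A.filter fun j => p j = p k) w f * w i := by
    intro i hi
    rw [Finset.mem_filter] at hi
    rw [hr i hi.1 k hk hi.2, fiberAvg, hi.2]
    ring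
  have h2 : ∀ i ∈ A.filter fun j => p j = p k, r i * w i * f i = r k * (w i * f i) := by
    intro i hi
    rw [Finset.mem_filter] at hi
    rw [hr i hi.1 k hk hi.2, mul_assoc]
  rw [Finset.sum_congr rfl h1, Finset.sum_congr rfl h2, ← Finset.mul_sum, ← Finset.mul_sum,
    weightedAvg]
  field_simp

theorem weightedAvg_fiberAvg [DecidableEq κ] (hw : ∀ i, 0 < w i) (p : ι → κ) (f : ι → ℝ) :
    weightedAvg A w (fiberAvg A w p f) = weightedAvg A w f := by
  have := sum_mul_fiberAvg (A := A) (f := f) hw p (r := fun _ => 1) (fun _ _ _ _ _ => rfl)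
  simp only [one_mul] at this
  rw [weightedAvg, this, weightedAvg]

/-- If `u` has density between `ε * M` and `M` with respect to `w`, then a nonnegative function has
`u`-average at least `ε` times its `w`-average. -/
theorem mul_weightedAvg_le_weightedAvg (hA : A.Nonempty) (hw : ∀ i, 0 < w i) (hu : ∀ i, 0 < u i)
    {ε M : ℝ} (hε : 0 ≤ ε) (hl : ∀ i ∈ A, ε * M * w i ≤ u i) (hM : ∀ i ∈ A, u i ≤ M * w i)
    (hf : ∀ i ∈ A, 0 ≤ f i) : ε * weightedAvg A w f ≤ weightedAvg A u f := by
  have hW : 0 < ∑ i ∈ A, w i := Finset.sum_pos (fun i _ => hw i) hA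
  have hU : 0 < ∑ i ∈ A, u i := Finset.sum_pos (fun i _ => hu i) hA
  have h1 : ∑ i ∈ A, u i ≤ M * ∑ i ∈ A, w i := by
    rw [Finset.mul_sum]
    exact Finset.sum_le_sum hM
  have h2 : ε * M * ∑ i ∈ A, w i * f i ≤ ∑ i ∈ A, u i * f i := by
    rw [Finset.mul_sum]
    refine Finset.sum_le_sum fun i hi => ?_
    rw [← mul_assoc]
    exact mul_le_mul_of_nonneg_right (hl i hi) (hf i hi)
  have h3 : 0 ≤ ∑ i ∈ A, w i * f i := Finset.sum_nonneg fun i hi => mul_nonneg (hw i).le (hf i hi)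
  rw [weightedAvg, weightedAvg, ← mul_div_assoc, div_le_div_iff₀ hW hU]
  calc ε * (∑ i ∈ A, w i * f i) * ∑ i ∈ A, u i
      ≤ ε * (∑ i ∈ A, w i * f i) * (M * ∑ i ∈ A, w i) := by gcongr
    _ = (ε * M * ∑ i ∈ A, w i * f i) * ∑ i ∈ A, w i := by ring
    _ ≤ _ := by gcongr

/-- Changing the weight by a density with values in `[ε * M, M]` that is constant on the fibres of
`p` changes an average by at most `1 - ε` times the oscillation of the fibre averages. -/
theorem abs_weightedAvg_sub_weightedAvg_le [DecidableEq κ] (hA : A.Nonempty) (hw : ∀ i, 0 < w i)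
    (p : ι → κ) {r : ι → ℝ} (hr : ∀ i ∈ A, ∀ j ∈ A, p i = p j → r i = r j)
    (hu : ∀ i, 0 < u i) (hur : ∀ i ∈ A, u i = r i * w i) {ε M D : ℝ} (hε : 0 ≤ ε) (hε1 : ε ≤ 1)
    (hl : ∀ i ∈ A, ε * M ≤ r i) (hM : ∀ i ∈ A, r i ≤ M)
    (hD : ∀ i ∈ A, ∀ j ∈ A, |fiberAvg A w p f i - fiberAvg A w p f j| ≤ D) :
    |weightedAvg A u f - weightedAvg A w f| ≤ (1 - ε) * D := by
  have hu' : weightedAvg A u (fiberAvg A w p f) = weightedAvg A u f := by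
    rw [weightedAvg, weightedAvg]
    congr 1
    calc _ = ∑ i ∈ A, r i * w i * fiberAvg A w p f i :=
          Finset.sum_congr rfl fun i hi => by rw [hur i hi]
      _ = ∑ i ∈ A, r i * w i * f i := sum_mul_fiberAvg hw p hr
      _ = _ := Finset.sum_congr rfl fun i hi => by rw [hur i hi]
  have hl' : ∀ i ∈ A, ε * M * w i ≤ u i := fun i hi => by
    rw [hur i hi]; exact mul_le_mul_of_nonneg_right (hl i hi) (hw i).le
  have hM' : ∀ i ∈ A, u i ≤ M * w i := fun i hi => by
    rw [hur i hi]; exact mul_le_mul_of_nonneg_right (hM i hi) (hw i).le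
  rw [← hu', ← weightedAvg_fiberAvg hw p f]
  generalize fiberAvg A w p f = h at hD
  have key : ∀ h : ι → ℝ, (∀ i ∈ A, ∀ j ∈ A, h i - h j ≤ D) →
      weightedAvg A w h - weightedAvg A u h ≤ (1 - ε) * D := by
    intro h hD
    obtain ⟨k, hk, hmin⟩ := A.exists_min_image h hA
    have h1 := mul_weightedAvg_le_weightedAvg (f := fun i => h i - h k) hA hw hu hε hl' hM'
      fun i hi => sub_nonneg.2 (hmin i hi)
    have h2 := weightedAvg_le (f := fun i => h i - h k) hA hw fun i hi => hD i hi k hk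
    rw [weightedAvg_sub_const hA hw] at h1 h2
    rw [weightedAvg_sub_const hA hu] at h1
    nlinarith [mul_le_mul_of_nonneg_left h2 (sub_nonneg.2 hε1)]
  rw [abs_sub_le_iff]
  constructor
  · have := key (fun i => -h i) fun i hi j hj => by linarith [(abs_le.1 (hD i hi j hj)).1]
    rw [weightedAvg_neg, weightedAvg_neg] at this
    linarith
  · exact key h fun i hi j hj => (abs_le.1 (hD i hi j hj)).2

/-- A form of Hoeffding's lemma for weighted averages. -/
theorem weightedAvg_exp_sub_avg_le (hA : A.Nonempty) (hw : ∀ i, 0 < w i) {K : ℝ}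
    (h : ∀ i ∈ A, ∀ j ∈ A, |f i - f j| ≤ K) (lam : ℝ) :
    weightedAvg A w (fun i => Real.exp (lam * (f i - weightedAvg A w f))) ≤
      Real.exp (lam ^ 2 * K ^ 2 / 2) := by
  set m := weightedAvg A w f
  have hW : 0 < ∑ i ∈ A, w i := Finset.sum_pos (fun i _ => hw i) hA
  have jensen : Real.exp (-(lam * m)) ≤ weightedAvg A w fun i => Real.exp (-(lam * f i)) := by
    have h0 : weightedAvg A w (fun i => (-(lam * (f i - m)) + 1)) = 1 := by
      rw [weightedAvg_add, weightedAvg_const hA hw, weightedAvg_neg, weightedAvg_const_mul,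
        weightedAvg_sub_const hA hw]
      simp [m]
    have h1 := weightedAvg_mono (A := A) (f := fun i => -(lam * (f i - m)) + 1)
      (g := fun i => Real.exp ((-lam) * (f i - m))) hw
      fun i _ => by rw [neg_mul]; exact Real.add_one_le_exp _
    rw [h0, weightedAvg_exp_sub] at h1
    calc Real.exp (-(lam * m)) = Real.exp (-(lam * m)) * 1 := by rw [mul_one]
      _ ≤ Real.exp (-(lam * m)) * _ := mul_le_mul_of_nonneg_left h1 (Real.exp_pos _).le
      _ = _ := by
        rw [← mul_assoc, ← Real.exp_add]
        simp
  have hpos : 0 ≤ weightedAvg A w fun i => Real.exp (lam * f i) :=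
    div_nonneg (Finset.sum_nonneg fun i _ => mul_nonneg (hw i).le (Real.exp_pos _).le) hW.le
  rw [weightedAvg_exp_sub]
  refine (mul_le_mul_of_nonneg_right jensen hpos).trans ?_
  rw [weightedAvg, weightedAvg, div_mul_div_comm, div_le_iff₀ (by positivity),
    Finset.sum_mul_sum, Finset.sum_mul_sum]
  have hsymm : ∑ i ∈ A, ∑ j ∈ A, w i * Real.exp (-(lam * f i)) * (w j * Real.exp (lam * f j)) =
      ∑ i ∈ A, ∑ j ∈ A, w i * w j * Real.cosh (lam * (f i - f j)) := by
    have e1 : ∀ i j, w i * w j * Real.cosh (lam * (f i - f j)) =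
        (w i * Real.exp (-(lam * f i)) * (w j * Real.exp (lam * f j)) +
          w j * Real.exp (-(lam * f j)) * (w i * Real.exp (lam * f i))) / 2 := by
      intro i j
      rw [Real.cosh_eq]
      have a1 : lam * (f i - f j) = lam * f i + -(lam * f j) := by ring
      rw [a1, neg_add, neg_neg, Real.exp_add, Real.exp_add]
      ring
    simp only [e1, ← Finset.sum_div, Finset.sum_add_distrib]
    rw [Finset.sum_comm (f := fun i j => w j * Real.exp (-(lam * f j)) *
      (w i * Real.exp (lam * f i)))]
    ring
  rw [hsymm, Finset.mul_sum]
  refine Finset.sum_le_sum fun i hi => ?_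
  rw [Finset.mul_sum]
  refine Finset.sum_le_sum fun j hj => ?_
  rw [mul_comm]
  refine mul_le_mul_of_nonneg_right ((Real.cosh_le_exp_half_sq _).trans ?_)
    (mul_pos (hw i) (hw j)).le
  rw [Real.exp_le_exp, mul_pow, ← sq_abs (f i - f j)]
  have := h i hi j hj
  gcongr

/-- Conditioning step of the martingale method: if the exponential moments within the fibres of `p`
are at most `B`, and the fibre averages have oscillation at most `K`. -/
theorem weightedAvg_exp_le_of_fiber [DecidableEq κ] (hA : A.Nonempty) (hw : ∀ i, 0 < w i)
    (p : ι → κ) {K B lam : ℝ}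
    (hK : ∀ i ∈ A, ∀ j ∈ A, |fiberAvg A w p f i - fiberAvg A w p f j| ≤ K)
    (hB : ∀ i ∈ A, fiberAvg A w p
      (fun j => Real.exp (lam * (f j - fiberAvg A w p f i))) i ≤ B) :
    weightedAvg A w (fun i => Real.exp (lam * (f i - weightedAvg A w f))) ≤
      B * Real.exp (lam ^ 2 * K ^ 2 / 2) := by
  have hB0 : 0 ≤ B := by
    obtain ⟨i, hi⟩ := hA
    exact (div_nonneg (Finset.sum_nonneg fun i _ => mul_nonneg (hw i).le (Real.exp_pos _).le)
      (Finset.sum_nonneg fun i _ => (hw i).le)).trans (hB i hi)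
  have h1 := weightedAvg_exp_sub_avg_le hA hw hK lam
  rw [weightedAvg_fiberAvg hw] at h1
  refine le_trans ?_ (mul_le_mul_of_nonneg_left h1 hB0)
  rw [← weightedAvg_fiberAvg hw p, ← weightedAvg_const_mul]
  refine weightedAvg_mono hw fun i hi => ?_
  have h2 := hB i hi
  rw [fiberAvg, weightedAvg_exp_sub] at h2 ⊢
  calc _ = Real.exp (lam * (fiberAvg A w p f i - weightedAvg A w f)) *
        (Real.exp (-(lam * fiberAvg A w p f i)) *
          weightedAvg (A.filter fun j => p j = p i) w fun j => Real.exp (lam * f j)) := by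
        rw [← mul_assoc, ← Real.exp_add]
        ring_nf
    _ ≤ Real.exp (lam * (fiberAvg A w p f i - weightedAvg A w f)) * B := by gcongr
    _ = _ := mul_comm _ _

end WeightedAvg

namespace PlantedModel

variable {n d : ℕ}

instance : Finite (Pairing n d) :=
  inferInstanceAs (Finite {m : Clone n d → Clone n d // Function.Involutive m ∧ ∀ x, m x ≠ x})

noncomputable instance : Fintype (Pairing n d) := Fintype.ofFinite _

instance : MeasurableSingletonClass (Pairing n d) := ⟨fun _ => trivial⟩

namespace Pairing

@[ext]
theorem ext {G G' : Pairing n d} (h : ∀ x, G.partner x = G'.partner x) : G = G' :=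
  Subtype.ext (funext h)

@[simp]
theorem partner_partner (G : Pairing n d) (x : Clone n d) : G.partner (G.partner x) = x :=
  G.2.1 x

theorem partner_ne (G : Pairing n d) (x : Clone n d) : G.partner x ≠ x :=
  G.2.2 x

theorem partner_injective (G : Pairing n d) : Function.Injective G.partner :=
  G.2.1.injective

/-- The pairing obtained by renaming the clones by a permutation. -/
def relabel (τ : Equiv.Perm (Clone n d)) (G : Pairing n d) : Pairing n d :=
  ⟨fun x => τ (G.partner (τ.symm x)), fun x => by simp, fun x h =>
    G.partner_ne (τ.symm x) ((Equiv.eq_symm_apply τ).2 h)⟩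

@[simp]
theorem relabel_partner (τ : Equiv.Perm (Clone n d)) (G : Pairing n d) (x : Clone n d) :
    (G.relabel τ).partner x = τ (G.partner (τ.symm x)) := rfl

theorem isSwitch_relabel_swap (G : Pairing n d) {a y : Clone n d} (hya : y ≠ a)
    (hy : y ≠ G.partner a) : IsSwitch G (G.relabel (Equiv.swap (G.partner a) y)) := by
  have h1 : G.partner y ≠ a := fun h => hy (by rw [← h, partner_partner])
  have h2 : G.partner y ≠ G.partner a := fun h => hya (G.partner_injective h)
  have h3 := G.partner_ne y
  have h4 := G.partner_ne a
  refine ⟨a, G.partner y, h1, h2, ?_, ?_, fun x hxa hxb hxc hxd => ?_⟩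
  · rw [relabel_partner, Equiv.symm_swap, Equiv.swap_apply_of_ne_of_ne h4.symm hya.symm,
      Equiv.swap_apply_left, partner_partner]
  · rw [relabel_partner, Equiv.symm_swap, Equiv.swap_apply_left,
      Equiv.swap_apply_of_ne_of_ne h2 h3]
  · rw [partner_partner] at hxd
    rw [relabel_partner, Equiv.symm_swap, Equiv.swap_apply_of_ne_of_ne hxb hxd,
      Equiv.swap_apply_of_ne_of_ne]
    · exact fun h => hxa (G.partner_injective h)
    · exact fun h => hxc (by rw [← h, partner_partner])

end Pairing

/-- The number of clones whose partner has the same spin, for spins attached to the clones. -/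
noncomputable def monoClones (s : Clone n d → ℤˣ) (G : Pairing n d) : ℝ :=
  ∑ x, if s x = s (G.partner x) then 1 else 0

/-- The Boltzmann weight of a pairing, for spins attached to the clones. -/
noncomputable def boltzmann (β : ℝ) (s : Clone n d → ℤˣ) (G : Pairing n d) : ℝ :=
  Real.exp (β * (monoClones s G / 2))

theorem boltzmann_pos (β : ℝ) (s : Clone n d → ℤˣ) (G : Pairing n d) : 0 < boltzmann β s G :=
  Real.exp_pos _

theorem exp_monoEdges (β : ℝ) (σ : Spin n) (G : Pairing n d) :
    Real.exp (β * monoEdges G σ) = boltzmann β (fun x => σ x.1) G := by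
  simp [boltzmann, monoClones, monoEdges]

theorem boltzmann_relabel (β : ℝ) (s : Clone n d → ℤˣ) (τ : Equiv.Perm (Clone n d))
    (G : Pairing n d) : boltzmann β s (G.relabel τ) = boltzmann β (s ∘ τ) G := by
  rw [boltzmann, boltzmann, monoClones, monoClones, ← Equiv.sum_comp τ]
  simp

/-- Exchanging the spins of `G.partner a` and `y` only affects the edges at these two clones. -/
theorem monoClones_swap (s : Clone n d → ℤˣ) (G : Pairing n d) {a y : Clone n d} (hya : y ≠ a)
    (hy : y ≠ G.partner a) :
    monoClones (s ∘ Equiv.swap (G.partner a) y) G - monoClones s G =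
      2 * ((if s a = s y then 1 else 0) - if s a = s (G.partner a) then 1 else 0) +
      2 * ((if s (G.partner y) = s (G.partner a) then 1 else 0) -
        if s (G.partner y) = s y then 1 else 0) := by
  have h1 : G.partner y ≠ a := fun h => hy (by rw [← h, Pairing.partner_partner])
  have h2 : G.partner y ≠ G.partner a := fun h => hya (G.partner_injective h)
  have h3 := G.partner_ne y
  have h4 := G.partner_ne a
  rw [monoClones, monoClones, ← Finset.sum_sub_distrib,
    ← Finset.sum_subset (Finset.subset_univ {a, G.partner a, y, G.partner y})]
  · rw [Finset.sum_insert (by simp [h4.symm, hya.symm, h1.symm]),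
      Finset.sum_insert (by simp [hy.symm, h2.symm]), Finset.sum_insert (by simp [h3.symm]),
      Finset.sum_singleton]
    simp only [Function.comp_apply, Pairing.partner_partner, Equiv.swap_apply_left,
      Equiv.swap_apply_right, Equiv.swap_apply_of_ne_of_ne h4.symm hya.symm,
      Equiv.swap_apply_of_ne_of_ne h2 h3]
    simp only [eq_comm (a := s y) (b := s a), eq_comm (a := s (G.partner a)) (b := s a),
      eq_comm (a := s y) (b := s (G.partner y)),
      eq_comm (a := s (G.partner a)) (b := s (G.partner y))]
    ring
  · intro x _ hx
    simp only [Finset.mem_insert, Finset.mem_singleton, not_or] at hx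
    obtain ⟨hx1, hx2, hx3, hx4⟩ := hx
    have h5 : G.partner x ≠ G.partner a := fun h => hx1 (G.partner_injective h)
    have h6 : G.partner x ≠ y := fun h => hx4 (by rw [← h, Pairing.partner_partner])
    simp only [Function.comp_apply, Equiv.swap_apply_of_ne_of_ne hx2 hx3,
      Equiv.swap_apply_of_ne_of_ne h5 h6, sub_self]

/-- The pairings that agree with `m` on the clones in `U`. -/
noncomputable def cylinder (m : Pairing n d) (U : Finset (Clone n d)) : Finset (Pairing n d) :=
  Finset.univ.filter fun G => ∀ x ∈ U, G.partner x = m.partner x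

theorem mem_cylinder {m G : Pairing n d} {U : Finset (Clone n d)} :
    G ∈ cylinder m U ↔ ∀ x ∈ U, G.partner x = m.partner x := by
  simp [cylinder]

theorem cylinder_nonempty (m : Pairing n d) (U : Finset (Clone n d)) : (cylinder m U).Nonempty :=
  ⟨m, mem_cylinder.2 fun _ _ => rfl⟩

theorem cylinder_congr {m m' : Pairing n d} {U : Finset (Clone n d)}
    (h : ∀ x ∈ U, m.partner x = m'.partner x) : cylinder m U = cylinder m' U := by
  ext G
  rw [mem_cylinder, mem_cylinder]
  exact forall₂_congr fun x hx => by rw [h x hx]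

theorem filter_cylinder {m G : Pairing n d} {U : Finset (Clone n d)} (hG : G ∈ cylinder m U)
    (a : Clone n d) :
    ((cylinder m U).filter fun G' => G'.partner a = G.partner a) = cylinder G (insert a U) := by
  rw [mem_cylinder] at hG
  ext G'
  simp only [Finset.mem_filter, mem_cylinder, Finset.mem_insert, forall_eq_or_imp]
  rw [and_comm]
  exact and_congr_right fun _ => forall₂_congr fun x hx => by rw [hG x hx]

theorem fiberAvg_cylinder {m G : Pairing n d} {U : Finset (Clone n d)} (hG : G ∈ cylinder m U)
    (w f : Pairing n d → ℝ) (a : Clone n d) :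
    fiberAvg (cylinder m U) w (fun G' => G'.partner a) f G =
      weightedAvg (cylinder G (insert a U)) w f := by
  rw [fiberAvg, filter_cylinder hG]

theorem relabel_swap_mem_cylinder {m m' G : Pairing n d} {U : Finset (Clone n d)}
    (h : ∀ x ∈ U, m.partner x = m'.partner x) {a : Clone n d}
    (hne : m.partner a ≠ m'.partner a) (hG : G ∈ cylinder m (insert a U)) :
    G.relabel (Equiv.swap (m.partner a) (m'.partner a)) ∈ cylinder m' (insert a U) := by
  rw [mem_cylinder] at hG ⊢
  have haU : a ∉ U := fun ha => hne (h a ha)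
  intro x hx
  rw [Pairing.relabel_partner, Equiv.symm_swap]
  rcases Finset.mem_insert.1 hx with rfl | hxU
  · rw [Equiv.swap_apply_of_ne_of_ne (m.partner_ne x).symm (m'.partner_ne x).symm, hG x hx,
      Equiv.swap_apply_left]
  · have hxa : x ≠ a := fun e => haU (e ▸ hxU)
    have h1 : x ≠ m.partner a := by
      rintro rfl
      have := h _ hxU
      rw [Pairing.partner_partner] at this
      exact hne (m'.partner_injective (by rw [← this, Pairing.partner_partner]))
    have h2 : x ≠ m'.partner a := by
      rintro rfl
      have := h _ hxU
      rw [Pairing.partner_partner] at this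
      exact hne (m.partner_injective (by rw [this, Pairing.partner_partner]))
    rw [Equiv.swap_apply_of_ne_of_ne h1 h2, hG x hx, Equiv.swap_apply_of_ne_of_ne, h x hxU]
    · exact fun e => hxa (m.partner_injective e)
    · exact fun e => hxa (m'.partner_injective (by rw [← h x hxU, e]))

theorem relabel_relabel_swap (G : Pairing n d) (x y : Clone n d) :
    (G.relabel (Equiv.swap x y)).relabel (Equiv.swap x y) = G := by
  ext1 z
  simp

/-- Averages over two cylinders that differ in the partner of `a` are related by renaming the
clones. -/
theorem weightedAvg_cylinder_swap (β : ℝ) (s : Clone n d → ℤˣ) (f : Pairing n d → ℝ)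
    {m m' : Pairing n d} {U : Finset (Clone n d)}
    (h : ∀ x ∈ U, m.partner x = m'.partner x) {a : Clone n d}
    (hne : m.partner a ≠ m'.partner a) :
    weightedAvg (cylinder m' (insert a U)) (boltzmann β s) f =
      weightedAvg (cylinder m (insert a U))
        (boltzmann β (s ∘ Equiv.swap (m.partner a) (m'.partner a)))
        (fun G => f (G.relabel (Equiv.swap (m.partner a) (m'.partner a)))) := by
  have key : ∀ F : Pairing n d → ℝ, ∑ G ∈ cylinder m' (insert a U), F G =
      ∑ G ∈ cylinder m (insert a U),
        F (G.relabel (Equiv.swap (m.partner a) (m'.partner a))) := by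
    intro F
    refine (Finset.sum_bij' (fun G _ => G.relabel (Equiv.swap (m.partner a) (m'.partner a)))
      (fun G _ => G.relabel (Equiv.swap (m.partner a) (m'.partner a)))
      (fun G hG => relabel_swap_mem_cylinder h hne hG) (fun G hG => ?_)
      (fun G _ => relabel_relabel_swap G _ _) (fun G _ => relabel_relabel_swap G _ _)
      (fun _ _ => rfl)).symm
    rw [Equiv.swap_comm]
    exact relabel_swap_mem_cylinder (fun x hx => (h x hx).symm) hne.symm hG
  rw [weightedAvg, weightedAvg, key, key]
  simp only [boltzmann_relabel]

/-- Exposing the partner of one clone changes the conditional expectation of an `L`-Lipschitz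
function by a bounded multiple of `L`. -/
theorem abs_weightedAvg_cylinder_sub_le {β : ℝ} (hβ : 0 ≤ β) (s : Clone n d → ℤˣ)
    {f : Pairing n d → ℝ} {L : ℝ} (hf : ∀ G G', IsSwitch G G' → |f G - f G'| ≤ L) (hL : 0 ≤ L)
    {m m' : Pairing n d} {U : Finset (Clone n d)}
    (h : ∀ x ∈ U, m.partner x = m'.partner x) (a : Clone n d) :
    |weightedAvg (cylinder m (insert a U)) (boltzmann β s) f -
      weightedAvg (cylinder m' (insert a U)) (boltzmann β s) f| ≤ L * Real.exp (2 * β) := by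
  induction hk : Uᶜ.card using Nat.strong_induction_on generalizing U m m' a with
  | _ k ih =>
  subst hk
  by_cases hne : m.partner a = m'.partner a
  · rw [cylinder_congr (m := m) (m' := m') fun x hx => by
      rcases Finset.mem_insert.1 hx with rfl | hx
      exacts [hne, h x hx]]
    simpa using mul_nonneg hL (Real.exp_pos _).le
  have haU : a ∉ U := fun ha => hne (h a ha)
  have hlt : (insert a U)ᶜ.card < Uᶜ.card := by
    refine Finset.card_lt_card (Finset.compl_ssubset_compl.2 (Finset.ssubset_insert haU))
  have hpos := boltzmann_pos (n := n) (d := d) β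
  have hA := cylinder_nonempty m (insert a U)
  set A := cylinder m (insert a U) with hAdef
  set y := m'.partner a
  set τ := Equiv.swap (m.partner a) y with hτ
  have hya : y ≠ a := m'.partner_ne a
  have hpa : ∀ G ∈ A, G.partner a = m.partner a := fun G hG =>
    mem_cylinder.1 hG a (Finset.mem_insert_self _ _)
  rw [weightedAvg_cylinder_swap β s f h hne]
  have h1 : |weightedAvg A (boltzmann β (s ∘ τ)) f -
      weightedAvg A (boltzmann β (s ∘ τ)) fun G => f (G.relabel τ)| ≤ L := by
    refine abs_weightedAvg_sub_le hA (hpos _) fun G hG => hf _ _ ?_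
    rw [hτ, ← hpa G hG]
    exact G.isSwitch_relabel_swap hya (by rw [hpa G hG]; exact Ne.symm hne)
  have h2 : |weightedAvg A (boltzmann β (s ∘ τ)) f - weightedAvg A (boltzmann β s) f| ≤
      (1 - Real.exp (-(2 * β))) * (L * Real.exp (2 * β)) := by
    let c : ℝ := (if s a = s y then 1 else 0) - if s a = s (m.partner a) then 1 else 0
    let e : Clone n d → ℝ := fun z =>
      (if s z = s (m.partner a) then 1 else 0) - if s z = s y then 1 else 0
    have he : ∀ z, -1 ≤ e z ∧ e z ≤ 1 := by
      intro z
      simp only [e]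
      split_ifs <;> norm_num
    refine abs_weightedAvg_sub_weightedAvg_le hA (hpos _) (fun G => G.partner y)
      (r := fun G => Real.exp (β * (c + e (G.partner y)))) (M := Real.exp (β * (c + 1)))
      (fun G _ G' _ hGG => by rw [show G.partner y = G'.partner y from hGG]) (hpos _) (fun G hG => ?_)
      (Real.exp_pos _).le (Real.exp_le_one_iff.2 (by linarith)) (fun G _ => ?_) (fun G _ => ?_)
      fun G hG G' hG' => ?_
    · have := monoClones_swap s G hya (by rw [hpa G hG]; exact Ne.symm hne)
      rw [hpa G hG] at this
      rw [boltzmann, boltzmann, ← Real.exp_add]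
      congr 1
      have h3 : monoClones (s ∘ τ) G = monoClones s G + (2 * c + 2 * e (G.partner y)) := by
        rw [← this]
        ring
      rw [h3]
      ring
    · rw [← Real.exp_add, Real.exp_le_exp]
      nlinarith [(he (G.partner y)).1]
    · rw [Real.exp_le_exp]
      nlinarith [(he (G.partner y)).2]
    · rw [fiberAvg_cylinder hG, fiberAvg_cylinder hG']
      refine ih _ hlt (fun x hx => ?_) y rfl
      rw [mem_cylinder.1 hG x hx, mem_cylinder.1 hG' x hx]
  have h3 : L + (1 - Real.exp (-(2 * β))) * (L * Real.exp (2 * β)) = L * Real.exp (2 * β) := by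
    rw [Real.exp_neg]
    have := (Real.exp_pos (2 * β)).ne'
    field_simp
    ring
  rw [← h3]
  rw [abs_le] at h1 h2 ⊢
  constructor <;> linarith [h1.1, h1.2, h2.1, h2.2]

/-- Sub-Gaussian exponential moments of Lipschitz functions on cylinders. -/
theorem weightedAvg_cylinder_exp_le {β : ℝ} (hβ : 0 ≤ β) (s : Clone n d → ℤˣ)
    {f : Pairing n d → ℝ} {L : ℝ} (hf : ∀ G G', IsSwitch G G' → |f G - f G'| ≤ L) (hL : 0 ≤ L)
    (lam : ℝ) (m : Pairing n d) (U : Finset (Clone n d)) :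
    weightedAvg (cylinder m U) (boltzmann β s)
        (fun G => Real.exp (lam * (f G - weightedAvg (cylinder m U) (boltzmann β s) f))) ≤
      Real.exp (lam ^ 2 * (L * Real.exp (2 * β)) ^ 2 / 2) ^ Uᶜ.card := by
  induction hk : Uᶜ.card generalizing U m with
  | zero =>
    rw [Finset.card_eq_zero, Finset.compl_eq_empty_iff] at hk
    subst hk
    have : cylinder m Finset.univ = {m} := by
      ext G
      simp [mem_cylinder, Pairing.ext_iff]
    have hb := (boltzmann_pos β s m).ne'
    simp [this, weightedAvg, hb]
  | succ k ih =>
    obtain ⟨a, ha⟩ : Uᶜ.Nonempty := Finset.card_pos.1 (by omega)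
    have haU := Finset.mem_compl.1 ha
    have hcard : (insert a U)ᶜ.card = k := by
      rw [Finset.compl_insert, Finset.card_erase_of_mem ha, hk, Nat.add_sub_cancel]
    rw [pow_succ]
    refine weightedAvg_exp_le_of_fiber (cylinder_nonempty m U) (boltzmann_pos β s)
      (fun G => G.partner a) (fun G hG G' hG' => ?_) fun G hG => ?_
    · rw [fiberAvg_cylinder hG, fiberAvg_cylinder hG']
      refine abs_weightedAvg_cylinder_sub_le hβ s hf hL (fun x hx => ?_) a
      rw [mem_cylinder.1 hG x hx, mem_cylinder.1 hG' x hx]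
    · rw [fiberAvg_cylinder hG, fiberAvg_cylinder hG]
      exact ih G _ hcard


theorem integral_planted [Nonempty (Pairing n d)] (β : ℝ) (σ : Spin n) (f : Pairing n d → ℝ) :
    ∫ G, f G ∂(planted β σ) =
      weightedAvg Finset.univ (boltzmann (n := n) (d := d) β fun x => σ x.1) f := by
  have hu (g : Pairing n d → ℝ) : ∫ G, g G ∂(configModel n d) =
      (Fintype.card (Pairing n d) : ℝ)⁻¹ * ∑ G, g G := by
    rw [configModel, uniformOn, ProbabilityTheory.cond, integral_smul_measure, Measure.restrict_univ,
      integral_count, Measure.count_univ]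
    simp
  have hc : (Fintype.card (Pairing n d) : ℝ)⁻¹ ≠ 0 := by
    simp [Fintype.card_ne_zero]
  rw [planted, integral_tilted, hu]
  simp only [hu, exp_monoEdges, smul_eq_mul, div_mul_eq_mul_div, ← Finset.sum_div]
  rw [weightedAvg, ← mul_div_assoc, mul_div_mul_left _ _ hc]

theorem planted_real_le_of_one_le [Nonempty (Pairing n d)] (β : ℝ) (σ : Spin n)
    {S : Set (Pairing n d)} {g : Pairing n d → ℝ} (hg : ∀ G, 0 ≤ g G) (hS : ∀ G ∈ S, 1 ≤ g G) :
    (planted β σ).real S ≤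
      weightedAvg Finset.univ (boltzmann (n := n) (d := d) β fun x => σ x.1) g := by
  rw [← integral_indicator_one (show MeasurableSet S from trivial), integral_planted]
  refine weightedAvg_mono (boltzmann_pos _ _) fun G _ => ?_
  by_cases hG : G ∈ S
  · simpa [hG] using hS G hG
  · simpa [hG] using hg G

/-- One-sided concentration for Lipschitz functions under the planted model. -/
theorem planted_real_tail_le [Nonempty (Pairing n d)] {β : ℝ} (hβ : 0 ≤ β) (σ : Spin n)
    {f : Pairing n d → ℝ} {L : ℝ} (hf : ∀ G G', IsSwitch G G' → |f G - f G'| ≤ L) (hL : 0 < L)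
    (hn : 0 < n) (hd : 0 < d) {t : ℝ} (ht : 0 ≤ t) :
    (planted β σ).real {G : Pairing n d | t ≤ f G - ∫ G', f G' ∂(planted β σ)} ≤
      Real.exp (-(t ^ 2 / (2 * d * Real.exp (2 * β) ^ 2 * n * L ^ 2))) := by
  obtain ⟨m⟩ := ‹Nonempty (Pairing n d)›
  have hcyl : cylinder m ∅ = Finset.univ := by
    ext G
    simp [mem_cylinder]
  have hn' : (0 : ℝ) < n := Nat.cast_pos.2 hn
  have hd' : (0 : ℝ) < d := Nat.cast_pos.2 hd
  have hB := Real.exp_pos (2 * β)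
  let lam : ℝ := t / (n * d * (L * Real.exp (2 * β)) ^ 2)
  have hlam : 0 ≤ lam := by positivity
  have h1 := weightedAvg_cylinder_exp_le hβ (fun x : Clone n d => σ x.1) hf hL.le lam m ∅
  rw [hcyl, Finset.compl_empty, Finset.card_univ, Fintype.card_prod, Fintype.card_fin,
    Fintype.card_fin, ← Real.exp_nat_mul] at h1
  have : Nonempty (Pairing n d) := ⟨m⟩
  rw [integral_planted]
  set e := weightedAvg Finset.univ (boltzmann (n := n) (d := d) β fun x => σ x.1) f
  refine (planted_real_le_of_one_le β σ
    (g := fun G => Real.exp (-(lam * t)) * Real.exp (lam * (f G - e)))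
    (fun G => by positivity) fun G hG => ?_).trans ?_
  · rw [← Real.exp_add, Real.one_le_exp_iff]
    have := mul_le_mul_of_nonneg_left (show t ≤ f G - e from hG) hlam
    linarith
  · rw [weightedAvg_const_mul]
    refine (mul_le_mul_of_nonneg_left h1 (Real.exp_pos _).le).trans_eq ?_
    rw [← Real.exp_add]
    congr 1
    simp only [lam]
    push_cast
    field_simp
    ring

end PlantedModel

theorem mainTheorem8 (d : ℕ) (hd : 3 ≤ d) (β : ℝ) (hβ : 0 < β) :
    ∃ C : ℝ, 0 < C ∧
      ∀ η : ℝ, -1 < η → η < 1 →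
      ∀ n : ℕ, 0 < n → Even (d * n) →
      ∀ (X : PlantedModel.Pairing n d → PlantedModel.Spin n → ℝ) (L : ℝ), 0 < L →
        (∀ σ ∈ PlantedModel.Omega n η, ∀ G G' : PlantedModel.Pairing n d,
          PlantedModel.IsSwitch G G' → |X G σ - X G' σ| ≤ L) →
        ∀ σ ∈ PlantedModel.Omega n η, ∀ t : ℝ, 0 < t →
          (PlantedModel.planted β σ).real
              {G : PlantedModel.Pairing n d |
                t ≤ |X G σ - ∫ G', X G' σ ∂(PlantedModel.planted β σ)|}
            ≤ 2 * Real.exp (-(t ^ 2 / (C * (n : ℝ) * L ^ 2))) := by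
  have hd0 : 0 < d := by omega
  refine ⟨2 * d * Real.exp (2 * β) ^ 2, by positivity, ?_⟩
  intro η _ _ n hn _ X L hL hX σ hσ t ht
  rcases isEmpty_or_nonempty (PlantedModel.Pairing n d) with hE | hE
  · rw [Set.eq_empty_of_isEmpty {G : PlantedModel.Pairing n d | _}, measureReal_empty]
    positivity
  have h1 := PlantedModel.planted_real_tail_le hβ.le σ (f := fun G => X G σ) (hX σ hσ) hL hn hd0
    ht.le
  have h2 := PlantedModel.planted_real_tail_le hβ.le σ (f := fun G => -X G σ)
    (fun G G' h => by
      rw [neg_sub_neg, abs_sub_comm]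
      exact hX σ hσ G G' h) hL hn hd0 ht.le
  rw [integral_neg] at h2
  have : MeasureTheory.IsFiniteMeasure (PlantedModel.planted (n := n) (d := d) β σ) := by
    rw [PlantedModel.planted]
    infer_instance
  rw [two_mul]
  refine le_trans ?_ ((measureReal_union_le _ _).trans (add_le_add h1 h2))
  refine measureReal_mono fun G hG => ?_
  rcases le_abs.1 (show t ≤ |_| from hG) with h | h
  · exact Or.inl h
  · refine Or.inr ?_
    change t ≤ -X G σ - -_
    linarith
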